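/- For an integer $m\ge 0$ let $p(m)$ be the number of partitions of $m$ (so $p(0)=1$), and put $p(m)=0$ for $m<0$. For a partition $\lambda$ and an integer $r\ge 1$ let $g_r(\lambda)$ be the smallest positive integer that occurs fewer than $r$ times as a part of $\lambda$. For an integer $n\ge 0$ let $S_3(n)=\sum_{\lambda\vdash n} g_3(\lambda)$, let $G_3(n)$ be the number of partitions $\lambda$ of $n$ with $g_3(\lambda)<g_2(\lambda)$, and let $R(n)$ be the number of partitions of $n$ with nonnegative rank, where the rank of a partition is its largest part minus its number of parts (the empty partition of $0$ has rank $0$). Then, for every integer $n\ge 0$, $$\text{(i)}\quad \sum_{k=0}^\infty p\bigl(n-k(6k+1)\bigr)=\frac{S_3(n)+G_3(n)+R(n)}{2},$$ $$\text{(ii)}\quad \sum_{k=0}^\infty p\bigl(n-(2k+1)(3k+2)\bigr)=\frac{S_3(n)+G_3(n)-R(n)}{2}.$$ -/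

import Mathlib

namespace LeastGap

/-- Euler's partition function on the integers: `p m` is the number of partitions of `m`
for `m ≥ 0` (so `p 0 = 1`), and `p m = 0` for `m < 0`. -/
def p (m : ℤ) : ℕ :=
  if 0 ≤ m then Fintype.card (Nat.Partition m.toNat) else 0

/-- The least `r`-gap of a partition: the smallest positive integer that occurs less than `r`
times as a part. For `r = 0` there is no such integer and the value is `∞`. -/
noncomputable def gap (r : ℕ) {n : ℕ} (l : Nat.Partition n) : ℕ∞ :=
  sInf ((fun j : ℕ => (j : ℕ∞)) '' {j : ℕ | 1 ≤ j ∧ l.parts.count j < r})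

theorem gap_zero {n : ℕ} (l : Nat.Partition n) : gap 0 l = ⊤ := by
  simp [gap]

/-- For `r ≥ 1` the least `r`-gap is finite. -/
theorem gap_ne_top {r : ℕ} (hr : 1 ≤ r) {n : ℕ} (l : Nat.Partition n) : gap r l ≠ ⊤ := by
  have hmem : n + 1 ∈ {j : ℕ | 1 ≤ j ∧ l.parts.count j < r} := by
    refine ⟨by omega, ?_⟩
    have h0 : l.parts.count (n + 1) = 0 := by
      refine Multiset.count_eq_zero.2 fun h => ?_
      have := Nat.Partition.le_of_mem_parts h
      omega
    omega
  have hle : gap r l ≤ ((n + 1 : ℕ) : ℕ∞) := sInf_le ⟨n + 1, hmem, rfl⟩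
  exact ne_top_of_le_ne_top (ENat.natCast_ne_top _) hle

/-- `S r n` is the sum of the least `r`-gaps over all partitions of `n`, for `r ≥ 1`
(the gaps are then finite, so `ENat.toNat` changes nothing). -/
noncomputable def S (r n : ℕ) : ℕ :=
  ∑ l : Nat.Partition n, (gap r l).toNat

/-- `G r n` is the number of partitions of `n` whose least `r`-gap is smaller than the least
`(r - 1)`-gap, for `r ≥ 1`. -/
noncomputable def G (r n : ℕ) : ℕ :=
  Nat.card {l : Nat.Partition n // gap r l < gap (r - 1) l}

/-- Dyson's rank: the largest part minus the number of parts
(the largest part of the empty partition is `0`, so its rank is `0`). -/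
def rank {n : ℕ} (l : Nat.Partition n) : ℤ :=
  (l.parts.sup : ℤ) - (l.parts.card : ℤ)

/-- The number of partitions of `n` with nonnegative rank. -/
noncomputable def R (n : ℕ) : ℕ :=
  Nat.card {l : Nat.Partition n // 0 ≤ rank l}

end LeastGap

namespace LeastGap

/-! ### Partitions containing a given multiset of parts -/

/-! Put T_j = j(3j+1)/2. Then T_{2k} = k(6k+1) and T_{2k+1} = (2k+1)(3k+2), so both claims follow by
splitting by parity from Σ p(n - T_j) = S_3 + G_3 and Σ (-1)^j p(n - T_j) = R.

For the first, T_j is the size of `staircase j`, so p(n - T_j) counts the partitions of n containing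
it. The j that work for a given λ form an initial segment of length g_3, or g_3 + 1 when g_3 < g_2
(`gap_three_add_indicator`).

For the second, Dyson's map yields `rankLE_add`, a recursion raising s by 3. Started at s = 1 it
removes 2, 5, 8, … = T_{k+1} - T_k from n, and iterating gives the alternating sum. -/

/-- Partitions of `n` whose parts contain `D` correspond to partitions of `n - D.sum`. -/
def partitionContainingEquiv {n m : ℕ} (D : Multiset ℕ) (hD : ∀ i ∈ D, 0 < i)
    (hn : n = m + D.sum) : {l : Nat.Partition n // D ≤ l.parts} ≃ Nat.Partition m where
  toFun l :=
    { parts := l.1.parts - D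
      parts_pos := fun hi => l.1.parts_pos (Multiset.mem_of_le (Multiset.sub_le_self _ _) hi)
      parts_sum := by
        have h := congrArg Multiset.sum (Multiset.sub_add_cancel l.2)
        rw [Multiset.sum_add, l.1.parts_sum] at h
        omega }
  invFun l :=
    ⟨{ parts := l.parts + D
       parts_pos := fun hi => (Multiset.mem_add.1 hi).elim (fun h => l.parts_pos h) (hD _)
       parts_sum := by rw [Multiset.sum_add, l.parts_sum, hn] }, Multiset.le_add_left _ _⟩
  left_inv l := by
    apply Subtype.ext
    apply Nat.Partition.ext
    exact Multiset.sub_add_cancel l.2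
  right_inv l := by
    apply Nat.Partition.ext
    exact Multiset.add_sub_cancel_right

theorem p_natCast (m : ℕ) : p m = Fintype.card (Nat.Partition m) := by
  simp [p]

theorem p_of_neg {m : ℤ} (hm : m < 0) : p m = 0 := by
  simp [p, hm]

theorem card_partition_containing (n : ℕ) (D : Multiset ℕ) (hD : ∀ i ∈ D, 0 < i) :
    Nat.card {l : Nat.Partition n // D ≤ l.parts} = p ((n : ℤ) - (D.sum : ℕ)) := by
  rcases le_or_gt D.sum n with h | h
  · obtain ⟨m, rfl⟩ := Nat.exists_eq_add_of_le' h
    rw [Nat.card_congr (partitionContainingEquiv D hD rfl), Nat.card_eq_fintype_card,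
      ← p_natCast]
    congr 1
    push_cast
    ring
  · rw [p_of_neg (by omega)]
    have : IsEmpty {l : Nat.Partition n // D ≤ l.parts} := by
      refine ⟨fun l => ?_⟩
      have h1 := congrArg Multiset.sum (Multiset.sub_add_cancel l.2)
      rw [Multiset.sum_add, l.1.parts_sum] at h1
      omega
    exact Nat.card_of_isEmpty

/-! ### The least gaps -/

/-- The multiset consisting of `1, …, j - 1` three times each and `j` twice. -/
def staircase : ℕ → Multiset ℕ
  | 0 => 0
  | k + 1 => Multiset.replicate 2 (k + 1) + 3 • (Finset.Icc 1 k).val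

theorem staircase_pos (j : ℕ) : ∀ i ∈ staircase j, 0 < i := by
  cases j with
  | zero => simp [staircase]
  | succ k =>
    intro i hi
    rcases Multiset.mem_add.1 hi with h | h
    · rw [Multiset.eq_of_mem_replicate h]; omega
    · have := Multiset.mem_of_mem_nsmul h
      rw [Finset.mem_val, Finset.mem_Icc] at this
      omega

theorem two_mul_sum_staircase (j : ℕ) : 2 * (staircase j).sum = j * (3 * j + 1) := by
  cases j with
  | zero => simp [staircase]
  | succ k =>
    have h : ∀ k : ℕ, 2 * (Finset.Icc 1 k).val.sum = k * (k + 1) := by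
      intro k
      induction k with
      | zero => simp
      | succ k ih =>
        have := Finset.sum_Icc_succ_top (a := 1) (b := k) (by omega) (fun i : ℕ => i)
        simp only [Finset.sum_eq_multiset_sum, Multiset.map_id'] at this
        rw [this, mul_add, ih]
        ring
    have h' := h k
    simp only [staircase, Multiset.sum_add, Multiset.sum_replicate, Multiset.sum_nsmul,
      smul_eq_mul]
    linarith

theorem staircase_le_iff (j : ℕ) (s : Multiset ℕ) :
    staircase j ≤ s ↔ (∀ i, 1 ≤ i → i < j → 3 ≤ s.count i) ∧ (1 ≤ j → 2 ≤ s.count j) := by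
  cases j with
  | zero => simp [staircase]
  | succ k =>
    have hc : ∀ i, (staircase (k + 1)).count i =
        (if k + 1 = i then 2 else 0) + 3 * (if 1 ≤ i ∧ i ≤ k then 1 else 0) := by
      intro i
      simp only [staircase, Multiset.count_add, Multiset.count_replicate, Multiset.count_nsmul,
        Multiset.count_eq_of_nodup (Finset.Icc 1 k).nodup, Finset.mem_val, Finset.mem_Icc]
    rw [Multiset.le_iff_count]
    constructor
    · intro h
      refine ⟨fun i h1 h2 => ?_, fun _ => ?_⟩
      · have := h i
        rw [hc, if_neg (by omega), if_pos ⟨h1, by omega⟩] at this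
        omega
      · have := h (k + 1)
        rw [hc, if_pos rfl] at this
        omega
    · rintro ⟨h1, h2⟩ i
      rw [hc]
      by_cases hi : k + 1 = i
      · subst hi
        rw [if_pos rfl, if_neg (by omega)]
        exact h2 (by omega)
      · rw [if_neg hi]
        by_cases hi' : 1 ≤ i ∧ i ≤ k
        · rw [if_pos hi']
          exact h1 i hi'.1 (by omega)
        · rw [if_neg hi']
          omega

theorem lt_gap_iff {r n : ℕ} (l : Nat.Partition n) (k : ℕ) :
    (k : ℕ∞) < gap r l ↔ ∀ i, 1 ≤ i → i ≤ k → r ≤ l.parts.count i := by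
  constructor
  · intro h i h1 h2
    by_contra hc
    have : gap r l ≤ (i : ℕ∞) := sInf_le ⟨i, ⟨h1, by omega⟩, rfl⟩
    exact absurd (h.trans_le this) (by simpa using h2)
  · intro h
    have : ((k + 1 : ℕ) : ℕ∞) ≤ gap r l := by
      refine le_sInf ?_
      rintro _ ⟨j, ⟨h1, h2⟩, rfl⟩
      have : k < j := by
        by_contra hk
        have := h j h1 (by omega)
        omega
      simpa using Nat.cast_le.2 this
    exact lt_of_lt_of_le (by exact_mod_cast Nat.lt_succ_self k) this

/-- A partition contains exactly `g₃ + [g₃ < g₂]` of the staircases. -/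
theorem gap_three_add_indicator {n N : ℕ} (hN : n < N) (l : Nat.Partition n)
    [Decidable (gap 3 l < gap 2 l)] [DecidablePred fun j => staircase j ≤ l.parts] :
    (gap 3 l).toNat + (if gap 3 l < gap 2 l then 1 else 0) =
      ((Finset.range N).filter fun j => staircase j ≤ l.parts).card := by
  obtain ⟨a, ha⟩ := ENat.ne_top_iff_exists.1 (gap_ne_top (r := 3) (by omega) l)
  have hlt : ∀ k : ℕ, k < a ↔ ∀ i, 1 ≤ i → i ≤ k → 3 ≤ l.parts.count i := fun k => by
    rw [← lt_gap_iff, ← ha, Nat.cast_lt]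
  have h2 := lt_gap_iff (r := 2) l a
  rw [ha] at h2
  have h0 : ∀ i, n < i → l.parts.count i = 0 := fun i hi =>
    Multiset.count_eq_zero.2 fun h => by
      have := Nat.Partition.le_of_mem_parts h
      omega
  have ha1 : 1 ≤ a := (hlt 0).2 fun i h1 h2 => by omega
  have haN : a ≤ n + 1 := by
    by_contra h
    have := (hlt (n + 1)).1 (by omega) (n + 1) (by omega) le_rfl
    have := h0 (n + 1) (by omega)
    omega
  have hnat : (gap 3 l).toNat = a := by rw [← ha, ENat.toNat_natCast]
  rw [hnat]
  split_ifs with hif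
  · have hca := h2.1 hif a ha1 le_rfl
    have han : a ≤ n := by
      by_contra h
      have := h0 a (by omega)
      omega
    rw [← Finset.card_range (a + 1)]
    congr 1
    ext j
    rw [Finset.mem_filter, Finset.mem_range, Finset.mem_range, staircase_le_iff]
    constructor
    · intro hj
      refine ⟨by omega, fun i h1 h2 => (hlt i).1 (by omega) i h1 le_rfl, fun hj1 => ?_⟩
      exact h2.1 hif j hj1 (by omega)
    · rintro ⟨-, hj, -⟩
      by_contra hja
      exact absurd ((hlt a).2 fun i h1 h2 => hj i h1 (by omega)) (lt_irrefl a)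
  · rw [add_zero, ← Finset.card_range a]
    congr 1
    ext j
    rw [Finset.mem_filter, Finset.mem_range, Finset.mem_range, staircase_le_iff]
    constructor
    · intro hj
      refine ⟨by omega, fun i h1 h2 => (hlt i).1 (by omega) i h1 le_rfl, fun hj1 => ?_⟩
      have := (hlt j).1 hj j hj1 le_rfl
      omega
    · rintro ⟨-, hj, hj'⟩
      by_contra hja
      rcases eq_or_lt_of_le (not_lt.1 hja) with rfl | h
      · refine hif (h2.2 fun i h1 h3 => ?_)
        rcases eq_or_lt_of_le h3 with rfl | h4
        · exact hj' ha1
        · have := hj i h1 h4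
          omega
      · exact absurd ((hlt a).2 fun i h1 h2 => hj i h1 (by omega)) (lt_irrefl a)

/-- Double counting of the pairs (λ, j) with `staircase j` contained in λ. -/
theorem S_three_add_G_three {n N : ℕ} (hN : n < N) :
    S 3 n + G 3 n = ∑ j ∈ Finset.range N, p ((n : ℤ) - (staircase j).sum) := by
  classical
  have hG : G 3 n = ∑ l : Nat.Partition n, if gap 3 l < gap 2 l then 1 else 0 := by
    rw [G, Nat.card_eq_fintype_card, Fintype.card_subtype, Finset.card_filter]
  have hS : S 3 n = ∑ l : Nat.Partition n, (gap 3 l).toNat := rfl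
  rw [hS, hG, ← Finset.sum_add_distrib,
    Finset.sum_congr rfl fun l _ => gap_three_add_indicator hN l]
  simp_rw [Finset.card_filter]
  rw [Finset.sum_comm]
  refine Finset.sum_congr rfl fun j _ => ?_
  rw [← card_partition_containing n _ (staircase_pos j), Nat.card_eq_fintype_card,
    Fintype.card_subtype, Finset.card_filter]

/-! ### Dyson's map and the rank -/

/-- Lowering all elements by one, dropping zeros, and raising again recovers a multiset of
positive numbers up to its ones. -/
theorem map_succ_filter_map_pred_add_replicate (t : Multiset ℕ) (ht : ∀ i ∈ t, 0 < i) :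
    ((t.map (· - 1)).filter (· ≠ 0)).map (· + 1) +
      Multiset.replicate (t.card - ((t.map (· - 1)).filter (· ≠ 0)).card) 1 = t := by
  induction t using Multiset.induction_on with
  | empty => simp
  | cons a t ih =>
    have ha := ht a (Multiset.mem_cons_self a t)
    have ih' := ih fun i hi => ht i (Multiset.mem_cons_of_mem hi)
    have hle : ((t.map (· - 1)).filter (· ≠ 0)).card ≤ t.card :=
      (Multiset.card_le_card (Multiset.filter_le _ _)).trans (by simp)
    rw [Multiset.map_cons]
    by_cases h : a - 1 = 0
    · rw [Multiset.filter_cons_of_neg (p := (· ≠ 0)) _ (by simpa using h), Multiset.card_cons,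
        Nat.succ_sub hle, Multiset.replicate_succ, Multiset.add_cons, ih']
      congr 1
      omega
    · rw [Multiset.filter_cons_of_pos (p := (· ≠ 0)) _ h, Multiset.card_cons, Multiset.card_cons,
        Nat.add_sub_add_right, Multiset.map_cons, Multiset.cons_add, ih']
      congr 1
      omega

theorem sum_map_pred_add_card (t : Multiset ℕ) (ht : ∀ i ∈ t, 0 < i) :
    (t.map (· - 1)).sum + t.card = t.sum := by
  induction t using Multiset.induction_on with
  | empty => simp
  | cons a t ih =>
    have ha := ht a (Multiset.mem_cons_self a t)
    have ih' := ih fun i hi => ht i (Multiset.mem_cons_of_mem hi)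
    simp only [Multiset.map_cons, Multiset.sum_cons, Multiset.card_cons]
    omega

theorem sum_filter_ne_zero (t : Multiset ℕ) : (t.filter (· ≠ 0)).sum = t.sum := by
  induction t using Multiset.induction_on with
  | empty => simp
  | cons a t ih =>
    by_cases h : a = 0
    · rw [Multiset.filter_cons_of_neg (p := (· ≠ 0)) _ (by simpa using h), ih, Multiset.sum_cons, h, zero_add]
    · rw [Multiset.filter_cons_of_pos (p := (· ≠ 0)) _ h, Multiset.sum_cons, Multiset.sum_cons, ih]

theorem sup_mem_of_ne_zero {t : Multiset ℕ} (ht : t ≠ 0) : t.sup ∈ t := by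
  induction t using Multiset.induction_on with
  | empty => exact absurd rfl ht
  | cons a t ih =>
    rw [Multiset.sup_cons]
    by_cases h : t = 0
    · simp [h]
    · rcases le_total a t.sup with h' | h'
      · rw [sup_eq_right.2 h']
        exact Multiset.mem_cons_of_mem (ih h)
      · rw [sup_eq_left.2 h']
        exact Multiset.mem_cons_self _ _

theorem filter_cons_sup_erase {t : Multiset ℕ} (ht : ∀ i ∈ t, 0 < i) :
    (t.sup ::ₘ t.erase t.sup).filter (· ≠ 0) = t := by
  by_cases h : t = 0
  · subst h
    rfl
  · rw [Multiset.cons_erase (sup_mem_of_ne_zero h), Multiset.filter_eq_self]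
    exact fun i hi => (ht i hi).ne'

theorem erase_sup_filter_cons {a : ℕ} {t : Multiset ℕ} (h : ∀ i ∈ t, i ≤ a) :
    ((a ::ₘ t).filter (· ≠ 0)).sup = a ∧
      ((a ::ₘ t).filter (· ≠ 0)).erase a = t.filter (· ≠ 0) := by
  by_cases ha : a = 0
  · subst ha
    have ht : t.filter (· ≠ 0) = 0 :=
      Multiset.filter_eq_nil.2 fun i hi => by simpa using h i hi
    rw [Multiset.filter_cons_of_neg (p := (· ≠ 0)) _ (by simp), ht]
    simp
  · rw [Multiset.filter_cons_of_pos (p := (· ≠ 0)) _ ha, Multiset.sup_cons, Multiset.erase_cons_head]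
    exact ⟨sup_eq_left.2 (Multiset.sup_le.2 fun i hi => h i (Multiset.mem_of_mem_filter hi)),
      rfl⟩

theorem sup_add_sum_erase_sup (t : Multiset ℕ) : t.sup + (t.erase t.sup).sum = t.sum := by
  by_cases h : t = 0
  · subst h
    rfl
  · rw [← Multiset.sum_cons, Multiset.cons_erase (sup_mem_of_ne_zero h)]

theorem sum_map_succ (t : Multiset ℕ) : (t.map (· + 1)).sum = t.sum + t.card := by
  simp [Multiset.sum_map_add]

/-- Makes Dyson's map well defined: the inserted row has nonnegative length and is at least as long
as every shortened row. -/
theorem le_card_of_rank_le {m s : ℕ} (l : Nat.Partition (m + s + 1)) (h : rank l ≤ -(s : ℤ)) :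
    s + 1 ≤ l.parts.card ∧ ∀ i ∈ l.parts.map (· - 1), i ≤ l.parts.card - s - 1 := by
  have hne : l.parts ≠ 0 := fun h0 => by
    have := l.parts_sum
    rw [h0, Multiset.sum_zero] at this
    omega
  have hpos := l.parts_pos (sup_mem_of_ne_zero hne)
  rw [rank] at h
  refine ⟨by omega, fun i hi => ?_⟩
  obtain ⟨j, hj, rfl⟩ := Multiset.mem_map.1 hi
  have := Multiset.le_sup hj
  omega

/-- For the inverse map: the restored column is long enough to reach all remaining rows. -/
theorem card_erase_sup_le {m s : ℕ} (l : Nat.Partition m) (h : -(s : ℤ) - 2 ≤ rank l) :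
    (l.parts.erase l.parts.sup).card ≤ l.parts.sup + s + 1 := by
  rw [rank] at h
  by_cases h0 : l.parts = 0
  · simp [h0]
  · rw [Multiset.card_erase_of_mem (sup_mem_of_ne_zero h0), Nat.pred_eq_sub_one]
    omega

/-- Dyson's map: remove the first column of the Ferrers diagram, of length `ℓ`, and insert a
row of length `ℓ - s - 1`. -/
def dysonEquiv (m s : ℕ) :
    {l : Nat.Partition (m + s + 1) // rank l ≤ -(s : ℤ)} ≃
      {l : Nat.Partition m // -(s : ℤ) - 2 ≤ rank l} where
  toFun l :=
    ⟨{ parts := ((l.1.parts.card - s - 1) ::ₘ l.1.parts.map (· - 1)).filter (· ≠ 0)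
       parts_pos := fun hi => Nat.pos_of_ne_zero (Multiset.mem_filter.1 hi).2
       parts_sum := by
        have h1 := (le_card_of_rank_le l.1 l.2).1
        have h2 := sum_map_pred_add_card l.1.parts fun i hi => l.1.parts_pos hi
        rw [l.1.parts_sum] at h2
        rw [sum_filter_ne_zero, Multiset.sum_cons]
        omega },
      by
        obtain ⟨h1, h2⟩ := le_card_of_rank_le l.1 l.2
        -- At most ℓ + 1 rows and largest part ℓ - s - 1 give rank at least -s - 2.
        have h3 := Multiset.card_le_card (Multiset.filter_le (· ≠ 0)
          ((l.1.parts.card - s - 1) ::ₘ l.1.parts.map (· - 1)))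
        rw [Multiset.card_cons, Multiset.card_map] at h3
        rw [rank, (erase_sup_filter_cons h2).1]
        dsimp only
        omega⟩
  invFun l :=
    ⟨{ parts := (l.1.parts.erase l.1.parts.sup).map (· + 1) +
        Multiset.replicate (l.1.parts.sup + s + 1 - (l.1.parts.erase l.1.parts.sup).card) 1
       parts_pos := by
        intro i hi
        rcases Multiset.mem_add.1 hi with h | h
        · obtain ⟨j, -, rfl⟩ := Multiset.mem_map.1 h
          exact Nat.succ_pos j
        · rw [Multiset.eq_of_mem_replicate h]
          exact Nat.one_pos
       parts_sum := by
        have h1 := card_erase_sup_le l.1 l.2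
        have h2 := sup_add_sum_erase_sup l.1.parts
        rw [l.1.parts_sum] at h2
        rw [Multiset.sum_add, sum_map_succ, Multiset.sum_replicate, smul_eq_mul]
        omega },
      by
        have h1 := card_erase_sup_le l.1 l.2
        rw [rank]
        dsimp only
        rw [Multiset.card_add, Multiset.card_map, Multiset.card_replicate]
        have h2 : ((l.1.parts.erase l.1.parts.sup).map (· + 1) + Multiset.replicate
            (l.1.parts.sup + s + 1 - (l.1.parts.erase l.1.parts.sup).card) 1).sup
            ≤ l.1.parts.sup + 1 := by
          refine Multiset.sup_le.2 fun i hi => ?_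
          rcases Multiset.mem_add.1 hi with h | h
          · obtain ⟨j, hj, rfl⟩ := Multiset.mem_map.1 h
            exact Nat.succ_le_succ (Multiset.le_sup (Multiset.mem_of_mem_erase hj))
          · rw [Multiset.eq_of_mem_replicate h]
            omega
        omega⟩
  left_inv l := by
    obtain ⟨h1, h2⟩ := le_card_of_rank_le l.1 l.2
    apply Subtype.ext
    apply Nat.Partition.ext
    dsimp only
    rw [(erase_sup_filter_cons h2).1, (erase_sup_filter_cons h2).2,
      show l.1.parts.card - s - 1 + s + 1 = l.1.parts.card by omega]
    exact map_succ_filter_map_pred_add_replicate _ fun i hi => l.1.parts_pos hi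
  right_inv l := by
    have h1 := card_erase_sup_le l.1 l.2
    apply Subtype.ext
    apply Nat.Partition.ext
    dsimp only
    rw [Multiset.card_add, Multiset.card_map, Multiset.card_replicate, Multiset.map_add,
      Multiset.map_map, Multiset.map_replicate,
      show (l.1.parts.erase l.1.parts.sup).card + (l.1.parts.sup + s + 1 -
        (l.1.parts.erase l.1.parts.sup).card) - s - 1 = l.1.parts.sup by omega,
      show ((· - 1) ∘ (· + 1) : ℕ → ℕ) = id from rfl, Multiset.map_id, ← Multiset.cons_add,
      Multiset.filter_add, filter_cons_sup_erase fun i hi => l.1.parts_pos hi, Nat.sub_self,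
      Multiset.filter_eq_nil.2 fun i hi => by simp [Multiset.eq_of_mem_replicate hi], add_zero]

/-- The number of partitions of `n` with rank at most `-s`. -/
noncomputable def rankLE (n s : ℕ) : ℕ :=
  Nat.card {l : Nat.Partition n // rank l ≤ -(s : ℤ)}

theorem card_rank_add_rankLE (n s : ℕ) :
    Nat.card {l : Nat.Partition n // 1 - (s : ℤ) ≤ rank l} + rankLE n s = p n := by
  classical
  rw [rankLE, p_natCast, Nat.card_eq_fintype_card, Nat.card_eq_fintype_card,
    ← Fintype.card_congr (Equiv.sumCompl fun l : Nat.Partition n => rank l ≤ -(s : ℤ)),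
    Fintype.card_sum, add_comm]
  congr 1
  exact Fintype.card_congr (Equiv.subtypeEquivRight fun l => by omega)

/-- The image of Dyson's map, rank at least -s - 2, is the complement of rank at most -(s + 3). -/
theorem rankLE_add (m s : ℕ) : rankLE (m + s + 1) s + rankLE m (s + 3) = p m := by
  rw [← card_rank_add_rankLE m (s + 3), rankLE, Nat.card_congr (dysonEquiv m s)]
  congr 1
  exact Nat.card_congr (Equiv.subtypeEquivRight fun l => by push_cast; omega)

/-- A nonempty partition has largest part at least 1 and at most m parts, so its rank is at least 1
- m; `1 ≤ s` excludes the empty one. -/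
theorem rankLE_eq_zero {m s : ℕ} (hs : 1 ≤ s) (h : m ≤ s) : rankLE m s = 0 := by
  have : IsEmpty {l : Nat.Partition m // rank l ≤ -(s : ℤ)} := by
    refine ⟨fun l => ?_⟩
    have h1 := l.2
    have h2 := sum_map_pred_add_card l.1.parts fun i hi => l.1.parts_pos hi
    rw [l.1.parts_sum] at h2
    rw [rank] at h1
    have h3 : l.1.parts ≠ 0 := fun h0 => by
      rw [h0] at h1
      simp at h1
      omega
    have := l.1.parts_pos (sup_mem_of_ne_zero h3)
    omega
  exact Nat.card_of_isEmpty

theorem rankLE_eq_alternating_sum (N k m : ℕ) (hm : m ≤ N) :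
    (rankLE m (3 * k + 1) : ℤ) = ∑ j ∈ Finset.range N, (-1) ^ j *
      (p ((m : ℤ) - ((staircase (k + j + 1)).sum - (staircase k).sum)) : ℤ) := by
  induction N generalizing k m with
  | zero =>
    rw [Finset.sum_range_zero, rankLE_eq_zero (by omega) (by omega)]
    rfl
  | succ N ih =>
    have hst : ∀ k, ((staircase (k + 1)).sum : ℤ) - (staircase k).sum = 3 * k + 2 := by
      intro k
      have h1 := two_mul_sum_staircase k
      have h2 := two_mul_sum_staircase (k + 1)
      have h3 : (k + 1) * (3 * (k + 1) + 1) = k * (3 * k + 1) + 2 * (3 * k + 2) := by ring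
      omega
    have hmono : ∀ j, (staircase (k + 1)).sum ≤ (staircase (k + j + 1)).sum := by
      intro j
      induction j with
      | zero => exact le_rfl
      | succ j ih =>
        have := hst (k + j + 1)
        rw [show k + (j + 1) + 1 = k + j + 1 + 1 by ring]
        omega
    have hk := hst k
    -- If m < T_{k+1} - T_k, every argument of `p` is negative and both sides vanish; otherwise one
    -- Dyson step passes to k + 1.
    rcases le_or_gt m (3 * k + 1) with h | h
    · rw [rankLE_eq_zero (by omega) h, Finset.sum_eq_zero]
      · rfl
      · intro j _
        have := hmono j
        rw [p_of_neg (by omega)]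
        simp
    · obtain ⟨r, rfl⟩ := Nat.exists_eq_add_of_lt h
      have h1 := rankLE_add r (3 * k + 1)
      have h2 := ih (k + 1) r (by omega)
      rw [show 3 * k + 1 + r + 1 = r + (3 * k + 1) + 1 by ring, Finset.sum_range_succ']
      rw [show 3 * (k + 1) + 1 = 3 * k + 1 + 3 by ring] at h2
      have h3 : (rankLE (r + (3 * k + 1) + 1) (3 * k + 1) : ℤ) =
          p r - rankLE r (3 * k + 1 + 3) := by
        rw [← h1]
        push_cast
        ring
      rw [h3, h2, sub_eq_neg_add, ← Finset.sum_neg_distrib]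
      congr 1
      · refine Finset.sum_congr rfl fun j _ => ?_
        rw [show k + (j + 1) + 1 = k + 1 + j + 1 by ring, pow_succ, mul_neg_one, neg_mul]
        congr 4
        push_cast [-Nat.cast_multiset_sum]
        omega
      · rw [pow_zero, one_mul, add_zero]
        congr 2
        push_cast [-Nat.cast_multiset_sum]
        omega

theorem R_eq_alternating_sum {n N : ℕ} (hN : n < N) :
    (R n : ℤ) = ∑ j ∈ Finset.range N, (-1) ^ j * (p ((n : ℤ) - (staircase j).sum) : ℤ) := by
  obtain ⟨M, rfl⟩ := Nat.exists_eq_add_of_lt hN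
  have h1 := card_rank_add_rankLE n 1
  have h2 := rankLE_eq_alternating_sum (n + M) 0 n (by omega)
  have hR : R n = Nat.card {l : Nat.Partition n // 1 - ((1 : ℕ) : ℤ) ≤ rank l} := by
    simp [R]
  rw [Finset.sum_range_succ']
  have h3 : (R n : ℤ) = p n - rankLE n 1 := by
    rw [← h1, hR]
    push_cast
    ring
  rw [h3, show 1 = 3 * 0 + 1 by ring, h2, sub_eq_neg_add, ← Finset.sum_neg_distrib]
  congr 1
  · refine Finset.sum_congr rfl fun j _ => ?_
    rw [pow_succ, mul_neg_one, neg_mul]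
    simp [staircase]
  · simp [staircase]

/-! ### Splitting into even and odd indices -/

theorem sum_range_even_odd (f : ℕ → ℝ) (M : ℕ) :
    ∑ k ∈ Finset.range M, f (2 * k) =
        (∑ j ∈ Finset.range (2 * M), f j + ∑ j ∈ Finset.range (2 * M), (-1) ^ j * f j) / 2 ∧
      ∑ k ∈ Finset.range M, f (2 * k + 1) =
        (∑ j ∈ Finset.range (2 * M), f j - ∑ j ∈ Finset.range (2 * M), (-1) ^ j * f j) / 2 := by
  induction M with
  | zero => simp
  | succ M ih =>
    rw [show 2 * (M + 1) = 2 * M + 1 + 1 by ring]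
    simp only [Finset.sum_range_succ, ih.1, ih.2, pow_succ, pow_mul]
    constructor <;> norm_num <;> ring

end LeastGap

theorem mainTheorem10 (n : ℕ) :
    HasSum (fun k : ℕ => (LeastGap.p ((n : ℤ) - (k : ℤ) * (6 * (k : ℤ) + 1)) : ℝ))
      (((LeastGap.S 3 n : ℝ) + (LeastGap.G 3 n : ℝ) + (LeastGap.R n : ℝ)) / 2) ∧
    HasSum (fun k : ℕ =>
        (LeastGap.p ((n : ℤ) - (2 * (k : ℤ) + 1) * (3 * (k : ℤ) + 2)) : ℝ))
      (((LeastGap.S 3 n : ℝ) + (LeastGap.G 3 n : ℝ) - (LeastGap.R n : ℝ)) / 2) := by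
  set f : ℕ → ℝ := fun j => LeastGap.p ((n : ℤ) - (LeastGap.staircase j).sum) with hf
  have hs : ∀ j, (2 : ℤ) * ((LeastGap.staircase j).sum : ℕ) = j * (3 * j + 1) := fun j => by
    exact_mod_cast LeastGap.two_mul_sum_staircase j
  have he : ∀ k : ℕ,
      (LeastGap.p ((n : ℤ) - (k : ℤ) * (6 * (k : ℤ) + 1)) : ℝ) = f (2 * k) := fun k => by
    have := hs (2 * k)
    push_cast [-Nat.cast_multiset_sum] at this
    simp only [hf]
    congr 3
    linarith
  have ho : ∀ k : ℕ, (LeastGap.p ((n : ℤ) - (2 * (k : ℤ) + 1) * (3 * (k : ℤ) + 2)) : ℝ) =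
      f (2 * k + 1) := fun k => by
    have := hs (2 * k + 1)
    push_cast [-Nat.cast_multiset_sum] at this
    simp only [hf]
    congr 3
    linarith
  -- T_j ≥ j, so both series are finite sums.
  have hzero : ∀ j, n < j → f j = 0 := fun j hj => by
    have := hs j
    simp only [hf]
    rw [LeastGap.p_of_neg (by nlinarith), Nat.cast_zero]
  have hT : (LeastGap.S 3 n : ℝ) + LeastGap.G 3 n = ∑ j ∈ Finset.range (2 * (n + 1)), f j := by
    rw [← Nat.cast_add, LeastGap.S_three_add_G_three (N := 2 * (n + 1)) (by omega), Nat.cast_sum]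
  have hR : (LeastGap.R n : ℝ) = ∑ j ∈ Finset.range (2 * (n + 1)), (-1) ^ j * f j := by
    rw [← Int.cast_natCast, LeastGap.R_eq_alternating_sum (N := 2 * (n + 1)) (by omega),
      Int.cast_sum]
    refine Finset.sum_congr rfl fun j _ => ?_
    simp only [hf, Int.cast_mul, Int.cast_pow, Int.cast_neg, Int.cast_one, Int.cast_natCast]
  simp_rw [he, ho]
  rw [hT, hR, ← (LeastGap.sum_range_even_odd f (n + 1)).1,
    ← (LeastGap.sum_range_even_odd f (n + 1)).2]
  constructor <;> refine hasSum_sum_of_ne_finset_zero fun k hk => hzero _ ?_ <;>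
    rw [Finset.mem_range] at hk <;> omega
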